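/- For integers $n,k\ge 0$ let $\mathcal{A}(n,k)$ be the set of all $n\times n$ matrices with entries in $\{0,1\}$ all of whose row sums and column sums equal $k$. For such a matrix $A=[a_{pq}]$ put $\sigma_{ij}(A)=\sum_{p=1}^{i}\sum_{q=1}^{j}a_{pq}$. The Bruhat order on $\mathcal{A}(n,k)$ is the partial order in which $A$ precedes $C$ if and only if $\sigma_{ij}(A)\ge\sigma_{ij}(C)$ for all $1\le i,j\le n$. Let $w(n,k)$ denote the width of this poset, i.e. the maximum cardinality of an antichain. Then for every integer $k\ge 2$, $$w(2k,k)\;\ge\; g(k)=\begin{cases}\dfrac{(k!)^4}{4^{k}} & \text{if } k \text{ is even},\\[2ex] \dfrac{[(k-1)!]^4}{4^{k-3}} & \text{if } k \text{ is odd}.\end{cases}$$ -/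

import Mathlib

/-- The class `A(R, S)` of all `m` by `n` matrices of zeros and ones with row sum vector `R` and
column sum vector `S`. -/
def BinaryMatrixClass {m n : ℕ} (R : Fin m → ℕ) (S : Fin n → ℕ) : Type :=
  {A : Matrix (Fin m) (Fin n) ℕ //
    (∀ i j, A i j = 0 ∨ A i j = 1) ∧ (∀ i, ∑ j, A i j = R i) ∧ (∀ j, ∑ i, A i j = S j)}

/-- The class `A(n, k)` of all square matrices of zeros and ones of order `n` with all row sums and
all column sums equal to `k`. -/
abbrev RegularBinaryMatrixClass (n k : ℕ) : Type :=
  BinaryMatrixClass (fun _ : Fin n => k) (fun _ : Fin n => k)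

/-- The matrix `Σ_A` of leading partial sums: its `(i, j)` entry is the sum of all entries `a_{pq}`
with `p ≤ i` and `q ≤ j`. -/
def leadingSum {m n : ℕ} (A : Matrix (Fin m) (Fin n) ℕ) : Matrix (Fin m) (Fin n) ℕ :=
  fun i j => ∑ p ∈ Finset.Iic i, ∑ q ∈ Finset.Iic j, A p q

theorem eq_of_sum_Iic_eq {n : ℕ} {f g : Fin n → ℕ}
    (h : ∀ i, ∑ p ∈ Finset.Iic i, f p = ∑ p ∈ Finset.Iic i, g p) : f = g := by
  funext i
  induction i using WellFoundedLT.induction with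
  | ind i ih =>
    have hi := h i
    rw [← Finset.Iio_insert, Finset.sum_insert (by simp), Finset.sum_insert (by simp),
      Finset.sum_congr rfl (fun p hp => ih p (Finset.mem_Iio.mp hp))] at hi
    exact Nat.add_right_cancel hi

theorem leadingSum_injective {m n : ℕ} :
    Function.Injective (leadingSum : Matrix (Fin m) (Fin n) ℕ → Matrix (Fin m) (Fin n) ℕ) := by
  intro A C h
  have h1 : ∀ j, (fun p => ∑ q ∈ Finset.Iic j, A p q) = fun p => ∑ q ∈ Finset.Iic j, C p q :=
    fun j => eq_of_sum_Iic_eq fun i => congrFun (congrFun h i) j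
  funext i
  exact eq_of_sum_Iic_eq fun j => congrFun (h1 j) i

/-- The Bruhat order on `A(R, S)`: `A` precedes `C` if and only if every entry of `Σ_A` is greater
than or equal to the corresponding entry of `Σ_C`. -/
instance BinaryMatrixClass.instPartialOrder {m n : ℕ} (R : Fin m → ℕ) (S : Fin n → ℕ) :
    PartialOrder (BinaryMatrixClass R S) where
  le A C := ∀ i j, leadingSum C.1 i j ≤ leadingSum A.1 i j
  le_refl _ _ _ := le_rfl
  le_trans _ _ _ h₁ h₂ i j := (h₂ i j).trans (h₁ i j)
  le_antisymm _ _ h₁ h₂ := Subtype.ext <| leadingSum_injective <| by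
    funext i j
    exact le_antisymm (h₂ i j) (h₁ i j)

instance BinaryMatrixClass.instFinite {m n : ℕ} (R : Fin m → ℕ) (S : Fin n → ℕ) :
    Finite (BinaryMatrixClass R S) := by
  refine Finite.of_injective
    (fun A : BinaryMatrixClass R S => fun (i : Fin m) (j : Fin n) => decide (A.1 i j = 1)) ?_
  intro A C h
  refine Subtype.ext ?_
  funext i j
  have hij : decide (A.1 i j = 1) = decide (C.1 i j = 1) := congrFun (congrFun h i) j
  rw [decide_eq_decide] at hij
  rcases A.2.1 i j with hA | hA <;> rcases C.2.1 i j with hC | hC <;> omega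

/-- The width of a finite partially ordered set: the maximum cardinality of an antichain. -/
noncomputable def posetWidth (α : Type*) [PartialOrder α] [Finite α] : ℕ :=
  sSup {c : ℕ | ∃ s : Set α, IsAntichain (· ≤ ·) s ∧ s.ncard = c}

/-- The supremum defining the width is an attained maximum. -/
theorem posetWidth_isGreatest (α : Type*) [PartialOrder α] [Finite α] :
    IsGreatest {c : ℕ | ∃ s : Set α, IsAntichain (· ≤ ·) s ∧ s.ncard = c} (posetWidth α) := by
  have hb : BddAbove {c : ℕ | ∃ s : Set α, IsAntichain (· ≤ ·) s ∧ s.ncard = c} :=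
    ⟨Nat.card α, by rintro c ⟨s, -, rfl⟩; exact Set.ncard_le_card s⟩
  exact ⟨Nat.sSup_mem ⟨0, ∅, by simp, by simp⟩ hb, fun c hc => le_csSup hb hc⟩

/-- `g(k) = (k!)^4 / 4^k` for even `k`, and `g(k) = ((k-1)!)^4 / 4^(k-3)` for odd `k`, as a rational
number. -/
def widthBound (k : ℕ) : ℚ :=
  if Even k then (k.factorial : ℚ) ^ 4 / 4 ^ k
  else ((k - 1).factorial : ℚ) ^ 4 / (4 : ℚ) ^ ((k : ℤ) - 3)

/-!
Cut a square matrix of order `2 k` into `k ^ 2` blocks of order `2`, and let each block be either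
the identity matrix or the exchange matrix. Every row and every column meets `k` blocks and picks
up exactly one `1` from each, so all these `2 ^ (k ^ 2)` matrices lie in `A(2k, k)`. Let `S` be the
set of positions of the exchange blocks. The leading sum at the upper left corner of a block
depends on `S` only through that corner entry (`sum_blockEntry_corner`), because all blocks have the
same line sums. Hence comparability of two such matrices forces inclusion of the corresponding sets
(`subset_of_blockMatrix_le`), and the subsets of size `⌊k ^ 2 / 2⌋` give an antichain, so that the
width of `A(2k, k)` is at least the middle binomial coefficient of `k ^ 2`
(`choose_middle_le_posetWidth`).

This coefficient is at least `2 ^ (k ^ 2) / (k ^ 2 + 1)`, which grows much faster than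
`(k!) ^ 4 / 4 ^ k`: the inequality `(k ^ 2 + 1) (k!) ^ 4 ≤ 4 ^ k 2 ^ (k ^ 2)` follows by induction
(`sq_add_one_mul_factorial_pow_four_le`). Finally `g(k) ≤ (k!) ^ 4 / 4 ^ k` for odd `k` as well,
since `64 ≤ k ^ 4` for `k ≥ 3` (`widthBound_le`).
-/

/-- The entries, indexed from `0`, of the infinite matrix made of blocks of order `2`: the block at
position `(a, b)` is the exchange matrix if `(a, b) ∈ S` and the identity matrix otherwise. -/
def blockEntry (S : Finset (ℕ × ℕ)) (p q : ℕ) : ℕ :=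
  if ((p / 2, q / 2) ∈ S ↔ p % 2 = q % 2) then 0 else 1

theorem blockEntry_add_right (S : Finset (ℕ × ℕ)) (p b : ℕ) :
    blockEntry S p (2 * b) + blockEntry S p (2 * b + 1) = 1 := by
  have h1 : 2 * b / 2 = b := by omega
  have h2 : (2 * b + 1) / 2 = b := by omega
  have h3 : 2 * b % 2 = 0 := by omega
  have h4 : (2 * b + 1) % 2 = 1 := by omega
  unfold blockEntry
  rw [h1, h2, h3, h4]
  by_cases h : (p / 2, b) ∈ S <;> rcases Nat.mod_two_eq_zero_or_one p with hp | hp <;> simp [h, hp]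

theorem blockEntry_add_left (S : Finset (ℕ × ℕ)) (a q : ℕ) :
    blockEntry S (2 * a) q + blockEntry S (2 * a + 1) q = 1 := by
  have h1 : 2 * a / 2 = a := by omega
  have h2 : (2 * a + 1) / 2 = a := by omega
  have h3 : 2 * a % 2 = 0 := by omega
  have h4 : (2 * a + 1) % 2 = 1 := by omega
  unfold blockEntry
  rw [h1, h2, h3, h4]
  by_cases h : (a, q / 2) ∈ S <;> rcases Nat.mod_two_eq_zero_or_one q with hq | hq <;> simp [h, hq]

theorem sum_blockEntry_right (S : Finset (ℕ × ℕ)) (p b : ℕ) :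
    ∑ q ∈ Finset.range (2 * b), blockEntry S p q = b := by
  induction b with
  | zero => simp
  | succ b ih =>
    rw [show 2 * (b + 1) = 2 * b + 1 + 1 by ring, Finset.sum_range_succ, Finset.sum_range_succ, ih,
      add_assoc, blockEntry_add_right]

theorem sum_blockEntry_left (S : Finset (ℕ × ℕ)) (a q : ℕ) :
    ∑ p ∈ Finset.range (2 * a), blockEntry S p q = a := by
  induction a with
  | zero => simp
  | succ a ih =>
    rw [show 2 * (a + 1) = 2 * a + 1 + 1 by ring, Finset.sum_range_succ, Finset.sum_range_succ, ih,
      add_assoc, blockEntry_add_left]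

/-- The leading sum at the upper left corner of the block `(a, b)`: up to a quantity that does not
depend on `S`, it is the entry at that corner. -/
theorem sum_blockEntry_corner (S : Finset (ℕ × ℕ)) (a b : ℕ) :
    ∑ p ∈ Finset.range (2 * a + 1), ∑ q ∈ Finset.range (2 * b + 1), blockEntry S p q =
      (2 * b + 1) * a + b + if (a, b) ∈ S then 0 else 1 := by
  have hcorner : blockEntry S (2 * a) (2 * b) = if (a, b) ∈ S then 0 else 1 := by
    simp [blockEntry]
  rw [Finset.sum_range_succ, Finset.sum_comm]
  simp only [sum_blockEntry_left]
  rw [Finset.sum_const, Finset.card_range, smul_eq_mul, Finset.sum_range_succ,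
    sum_blockEntry_right, hcorner, add_assoc]

/-- The square matrix of order `2 k` with entries `blockEntry S`, as an element of `A(2k, k)`. -/
def blockMatrix (k : ℕ) (S : Finset (ℕ × ℕ)) : RegularBinaryMatrixClass (2 * k) k :=
  ⟨fun i j => blockEntry S i j, by
    refine ⟨fun i j => ?_, fun i => ?_, fun j => ?_⟩
    · dsimp only [blockEntry]
      split_ifs <;> simp
    · rw [Fin.sum_univ_eq_sum_range (fun q => blockEntry S i q), sum_blockEntry_right]
    · rw [Fin.sum_univ_eq_sum_range (fun p => blockEntry S p j), sum_blockEntry_left]⟩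

theorem Fin.sum_Iic_eq_sum_range {n : ℕ} (f : ℕ → ℕ) (i : Fin n) :
    ∑ p ∈ Finset.Iic i, f p = ∑ p ∈ Finset.range (i + 1), f p := by
  rw [Nat.range_succ_eq_Iic, ← Fin.map_valEmbedding_Iic, Finset.sum_map]
  rfl

theorem leadingSum_blockMatrix (k : ℕ) (S : Finset (ℕ × ℕ)) (i j : Fin (2 * k)) :
    leadingSum (blockMatrix k S).1 i j =
      ∑ p ∈ Finset.range (i + 1), ∑ q ∈ Finset.range (j + 1), blockEntry S p q := by
  rw [← Fin.sum_Iic_eq_sum_range (fun p => ∑ q ∈ Finset.range (j + 1), blockEntry S p q)]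
  exact Finset.sum_congr rfl fun p _ => Fin.sum_Iic_eq_sum_range (fun q => blockEntry S p q) j

theorem subset_of_blockMatrix_le {k : ℕ} {S T : Finset (ℕ × ℕ)}
    (hS : S ⊆ Finset.range k ×ˢ Finset.range k) (h : blockMatrix k S ≤ blockMatrix k T) :
    S ⊆ T := by
  rintro ⟨a, b⟩ hab
  have hmem := hS hab
  rw [Finset.mem_product, Finset.mem_range, Finset.mem_range] at hmem
  have hle := h ⟨2 * a, by omega⟩ ⟨2 * b, by omega⟩
  rw [leadingSum_blockMatrix, leadingSum_blockMatrix, sum_blockEntry_corner,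
    sum_blockEntry_corner, if_pos hab] at hle
  by_contra hT
  rw [if_neg hT] at hle
  omega

theorem choose_middle_le_posetWidth (k : ℕ) :
    (k ^ 2).choose (k ^ 2 / 2) ≤ posetWidth (RegularBinaryMatrixClass (2 * k) k) := by
  set F := Finset.powersetCard (k ^ 2 / 2) (Finset.range k ×ˢ Finset.range k) with hF
  have key : ∀ S ∈ F, ∀ T ∈ F, blockMatrix k S ≤ blockMatrix k T → S = T := by
    intro S hS T hT h
    rw [hF, Finset.mem_powersetCard] at hS hT
    exact Finset.eq_of_subset_of_card_le (subset_of_blockMatrix_le hS.1 h) (by rw [hS.2, hT.2])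
  refine (posetWidth_isGreatest _).2 ⟨blockMatrix k '' (F : Set (Finset (ℕ × ℕ))), ?_, ?_⟩
  · rintro _ ⟨S, hS, rfl⟩ _ ⟨T, hT, rfl⟩ hne hle
    exact hne (congrArg _ (key S hS T hT hle))
  · rw [Set.InjOn.ncard_image fun S hS T hT h => key S hS T hT h.le, Set.ncard_coe_finset, hF,
      Finset.card_powersetCard, Finset.card_product, Finset.card_range, sq]

theorem two_pow_le_succ_mul_choose_middle (n : ℕ) : 2 ^ n ≤ (n + 1) * n.choose (n / 2) := by
  rw [← Nat.sum_range_choose]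
  simpa using Finset.sum_le_card_nsmul (Finset.range (n + 1)) n.choose _
    fun r _ => Nat.choose_le_middle r n

theorem sq_le_two_pow {n : ℕ} (hn : 4 ≤ n) : n ^ 2 ≤ 2 ^ n := by
  induction n, hn using Nat.le_induction with
  | base => norm_num
  | succ n hn ih => rw [pow_succ 2 n]; nlinarith

theorem sq_add_one_mul_factorial_pow_four_le {k : ℕ} (hk : 2 ≤ k) :
    (k ^ 2 + 1) * k.factorial ^ 4 ≤ 4 ^ k * 2 ^ k ^ 2 := by
  rcases hk.eq_or_lt with rfl | hk
  · norm_num [Nat.factorial]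
  induction k, hk using Nat.le_induction with
  | base => norm_num [Nat.factorial]
  | succ k hk ih =>
    have h1 : (k + 1) ^ 2 + 1 ≤ 2 * (k ^ 2 + 1) := by nlinarith
    have h2 : (k + 1) ^ 4 ≤ 4 ^ (k + 1) := by
      have h := Nat.pow_le_pow_left (sq_le_two_pow (show 4 ≤ k + 1 by omega)) 2
      rwa [← pow_mul, ← pow_mul, mul_comm (k + 1) 2, pow_mul 2 2] at h
    calc ((k + 1) ^ 2 + 1) * (k + 1).factorial ^ 4
        = ((k + 1) ^ 2 + 1) * (k + 1) ^ 4 * k.factorial ^ 4 := by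
          rw [Nat.factorial_succ, mul_pow, mul_assoc]
      _ ≤ 2 * (k ^ 2 + 1) * 4 ^ (k + 1) * k.factorial ^ 4 := by gcongr
      _ = 2 * 4 ^ (k + 1) * ((k ^ 2 + 1) * k.factorial ^ 4) := by ring
      _ ≤ 2 * 4 ^ (k + 1) * (4 ^ k * 2 ^ k ^ 2) :=
          Nat.mul_le_mul_left _ (ih (by omega))
      _ = 4 ^ (k + 1) * 2 ^ (k + 1) ^ 2 := by
          rw [show (4 : ℕ) = 2 ^ 2 by norm_num, ← pow_mul, ← pow_mul]
          ring

theorem widthBound_le {k : ℕ} (hk : 2 ≤ k) : widthBound k ≤ (k.factorial : ℚ) ^ 4 / 4 ^ k := by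
  unfold widthBound
  split_ifs with h
  · exact le_rfl
  · have hk3 : 3 ≤ k := by
      by_contra hlt
      exact h (by rw [show k = 2 by omega]; exact even_two)
    have h64 : (64 : ℚ) ≤ (k : ℚ) ^ 4 := by
      have : (3 : ℚ) ^ 4 ≤ (k : ℚ) ^ 4 := by gcongr; exact_mod_cast hk3
      linarith
    have hfac : (k.factorial : ℚ) = k * (k - 1).factorial := by
      exact_mod_cast (Nat.mul_factorial_pred (by omega)).symm
    rw [zpow_sub₀ (by norm_num), zpow_natCast, hfac, mul_pow, div_div_eq_mul_div, mul_comm]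
    gcongr
    norm_num
    exact h64

theorem mainTheorem1 (k : ℕ) (hk : 2 ≤ k) :
    widthBound k ≤ (posetWidth (RegularBinaryMatrixClass (2 * k) k) : ℚ) := by
  refine (widthBound_le hk).trans ?_
  rw [div_le_iff₀ (by positivity)]
  have h : (k ^ 2 + 1) * k.factorial ^ 4 ≤
      (k ^ 2 + 1) * (posetWidth (RegularBinaryMatrixClass (2 * k) k) * 4 ^ k) :=
    calc (k ^ 2 + 1) * k.factorial ^ 4 ≤ 4 ^ k * 2 ^ k ^ 2 :=
          sq_add_one_mul_factorial_pow_four_le hk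
      _ ≤ 4 ^ k * ((k ^ 2 + 1) * posetWidth (RegularBinaryMatrixClass (2 * k) k)) := by
          gcongr
          exact (two_pow_le_succ_mul_choose_middle _).trans
            (Nat.mul_le_mul_left _ (choose_middle_le_posetWidth k))
      _ = _ := by ring
  exact_mod_cast Nat.le_of_mul_le_mul_left h (by positivity)
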